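/- Let $K=\mathbb{C}$ and $\mathfrak g=\mathfrak{sl}_2(\mathbb{C})$ with standard basis $e,f,h$. For $d\ge 1$ let $\rho^{(d)}:\mathfrak{sl}_2(\mathbb{C})\to\mathbb{C}^{d\times d}$ be the $d$-dimensional irreducible representation, in the matrix form $$\rho^{(d)}(e)=\sum_{i=1}^{d-1} iE_{i,i+1},\qquad \rho^{(d)}(f)=\sum_{i=1}^{d-1}(d-i)E_{i+1,i},\qquad \rho^{(d)}(h)=\sum_{i=1}^{d}(d+1-2i)E_{i,i}.$$ Let $F_m=\mathbb{C}\langle x_1,\dots,x_m\rangle$ be the free associative algebra, and call $g\in F_m$ an identity of $(\mathfrak{sl}_2(\mathbb{C}),\rho^{(d)})$ if $g(\rho^{(d)}(A_1),\dots,\rho^{(d)}(A_m))=0$ for all $A_1,\dots,A_m\in\mathfrak{sl}_2(\mathbb{C})$. Let $I_m^{(d)}\subseteq F_m$ be the set of these identities and let $P_m=\mathrm{Span}\{x_{\pi(1)}\cdots x_{\pi(m)}\mid \pi\in S_m\}$, on which $\pi \in S_m$ acts by $x_i\mapsto x_{\pi(i)}$. For a partition $\lambda\vdash m$, let $\mathrm{mult}_\lambda(\mathfrak{sl}_2(\mathbb{C}),\rho^{(d)})$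 be the multiplicity of the irreducible character $\chi^\lambda$ of $S_m$ (the character of the Specht module of shape $\lambda$) in the character of the $S_m$-module $P_m/(I_m^{(d)}\cap P_m)$. Then: (i) For every $d\ge 2$, $\ \mathrm{mult}_{(d-1,1)}(\mathfrak{sl}_2(\mathbb{C}),\rho^{(d)})=d-1.$ (ii) For every $d\ge 2$, the elements $x_1^k[x_1,x_2]x_1^{d-2-k}\in F_2$, $k=0,1,\dots,d-2$, where $[x_1,x_2]=x_1x_2-x_2x_1$, are linearly independent modulo $I_2^{(d)}$. (iii) The multiplicities have no upper bound independent of $d$: for every $B\in\mathbb{N}$ there are $d\ge 1$, $m$ and $\lambda\vdash m$ with $\mathrm{mult}_\lambda(\mathfrak{sl}_2(\mathbb{C}),\rho^{(d)})>B$. -/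

import Mathlib

attribute [local instance 100] LieRing.ofAssociativeRing

/-- The identities in the variables `X` of a Lie algebra homomorphism `ρ : L → A` into an associative
algebra `A` (with its commutator bracket): the noncommutative polynomials that vanish under every
substitution of the variables by elements `ρ (a x)`, `a x ∈ L`. -/
def weakIdentities {K L A : Type*} [Field K] [LieRing L] [LieAlgebra K L] [Ring A] [Algebra K A]
    (ρ : L →ₗ⁅K⁆ A) (X : Type*) : Submodule K (FreeAlgebra K X) where
  carrier := {f | ∀ a : X → L, FreeAlgebra.lift K (fun x => ρ (a x)) f = 0}
  add_mem' := fun hf hg a => by rw [map_add, hf a, hg a, add_zero]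
  zero_mem' := fun a => map_zero _
  smul_mem' := fun c f hf a => by rw [map_smul, hf a, smul_zero]

/-- The action of the symmetric group on the free algebra by algebra automorphisms,
`π · x_i = x_{π i}`. -/
noncomputable def freeAlgebraPermRep (K : Type*) [Field K] (m : ℕ) :
    Representation K (Equiv.Perm (Fin m)) (FreeAlgebra K (Fin m)) where
  toFun π := (FreeAlgebra.lift K (fun i => FreeAlgebra.ι K (π i))).toLinearMap
  map_one' := by
    have h : FreeAlgebra.lift K (fun i => FreeAlgebra.ι K ((1 : Equiv.Perm (Fin m)) i)) =
        AlgHom.id K _ := by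
      ext i; simp
    rw [h]; rfl
  map_mul' π σ := by
    have h : FreeAlgebra.lift K (fun i => FreeAlgebra.ι K ((π * σ) i)) =
        (FreeAlgebra.lift K (fun i => FreeAlgebra.ι K (π i))).comp
          (FreeAlgebra.lift K (fun i => FreeAlgebra.ι K (σ i))) := by
      ext i; simp
    rw [h]; rfl

/-- The multilinear component `P_m` of the free algebra: the span of the monomials
`x_{π(1)} ⋯ x_{π(m)}`, `π ∈ S_m`. -/
noncomputable def multilinearPart (K : Type*) [Field K] (m : ℕ) :
    Submodule K (FreeAlgebra K (Fin m)) :=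
  Submodule.span K (Set.range fun π : Equiv.Perm (Fin m) =>
    (List.ofFn fun i => FreeAlgebra.ι K (π i)).prod)

theorem multilinearPart_le_comap (K : Type*) [Field K] (m : ℕ) (σ : Equiv.Perm (Fin m)) :
    multilinearPart K m ≤ (multilinearPart K m).comap (freeAlgebraPermRep K m σ) := by
  refine Submodule.span_le.2 ?_
  rintro _ ⟨π, rfl⟩
  refine Submodule.subset_span ⟨σ * π, ?_⟩
  simp [freeAlgebraPermRep, map_list_prod, List.map_ofFn, Function.comp_def]

theorem weakIdentities_le_comap {K L A : Type*} [Field K] [LieRing L] [LieAlgebra K L] [Ring A]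
    [Algebra K A] (ρ : L →ₗ⁅K⁆ A) (m : ℕ) (σ : Equiv.Perm (Fin m)) :
    weakIdentities ρ (Fin m) ≤ (weakIdentities ρ (Fin m)).comap (freeAlgebraPermRep K m σ) := by
  intro f hf a
  have h : (FreeAlgebra.lift K (fun i => ρ (a i))).comp
      (FreeAlgebra.lift K (fun i => FreeAlgebra.ι K (σ i))) =
      FreeAlgebra.lift K (fun i => ρ (a (σ i))) := by
    ext i; simp
  have h' := hf (fun i => a (σ i))
  rw [← h] at h'
  exact h'

/-- The `S_m`-module `P_m`. -/
noncomputable def multilinearRep (K : Type*) [Field K] (m : ℕ) :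
    Representation K (Equiv.Perm (Fin m)) (multilinearPart K m) :=
  (freeAlgebraPermRep K m).subrepresentation (multilinearPart K m) (multilinearPart_le_comap K m)

/-- The `S_m`-module `P_m / (I ∩ P_m)`, where `I` is the space of identities of `ρ`. -/
noncomputable def cocharacterRep {K L A : Type*} [Field K] [LieRing L] [LieAlgebra K L] [Ring A]
    [Algebra K A] (ρ : L →ₗ⁅K⁆ A) (m : ℕ) :
    Representation K (Equiv.Perm (Fin m))
      (multilinearPart K m ⧸ (weakIdentities ρ (Fin m)).comap (multilinearPart K m).subtype) :=
  (multilinearRep K m).quotient ((weakIdentities ρ (Fin m)).comap (multilinearPart K m).subtype)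
    (fun σ _ hf => weakIdentities_le_comap ρ m σ hf)

/-- The `m`-th cocharacter of `ρ`. -/
noncomputable def cocharacter {K L A : Type*} [Field K] [LieRing L] [LieAlgebra K L] [Ring A]
    [Algebra K A] (ρ : L →ₗ⁅K⁆ A) (m : ℕ) : Equiv.Perm (Fin m) → K :=
  (cocharacterRep ρ m).character

/-- The Young diagram of a partition: its row lengths are the parts in decreasing order. -/
def partitionDiagram {m : ℕ} (lam : Nat.Partition m) : YoungDiagram :=
  YoungDiagram.ofRowLens (lam.parts.sort (· ≥ ·)) (Multiset.pairwise_sort lam.parts (· ≥ ·)).sortedGE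

/-- Tableaux of shape `lam`: bijective fillings of the cells `(row, column)` by `Fin m`. -/
abbrev Tableau {m : ℕ} (lam : Nat.Partition m) : Type :=
  {c : ℕ × ℕ // c ∈ (partitionDiagram lam).cells} ≃ Fin m

/-- The Specht polynomial of a tableau: the product, over all pairs of cells `c`, `c'` in the same
column with `c` above `c'`, of `X (T c) - X (T c')`. -/
noncomputable def spechtPolynomial (K : Type*) [Field K] {m : ℕ} {lam : Nat.Partition m}
    (T : Tableau lam) : MvPolynomial (Fin m) K :=
  ∏ p : {c : ℕ × ℕ // c ∈ (partitionDiagram lam).cells} ×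
      {c : ℕ × ℕ // c ∈ (partitionDiagram lam).cells} with
      p.1.1.2 = p.2.1.2 ∧ p.1.1.1 < p.2.1.1,
    (MvPolynomial.X (T p.1) - MvPolynomial.X (T p.2))

/-- The Specht module of shape `lam`, as the span of the Specht polynomials. -/
noncomputable def spechtModule (K : Type*) [Field K] {m : ℕ} (lam : Nat.Partition m) :
    Submodule K (MvPolynomial (Fin m) K) :=
  Submodule.span K (Set.range fun T : Tableau lam => spechtPolynomial K T)

/-- The action of the symmetric group on polynomials by permuting the variables. -/
noncomputable def mvPolynomialPermRep (K : Type*) [Field K] (m : ℕ) :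
    Representation K (Equiv.Perm (Fin m)) (MvPolynomial (Fin m) K) where
  toFun π := (MvPolynomial.rename (R := K) π).toLinearMap
  map_one' := by
    refine LinearMap.ext fun p => ?_
    exact MvPolynomial.rename_id_apply p
  map_mul' π σ := by
    refine LinearMap.ext fun p => ?_
    exact (MvPolynomial.rename_rename σ π p).symm

theorem spechtModule_le_comap (K : Type*) [Field K] {m : ℕ} (lam : Nat.Partition m)
    (σ : Equiv.Perm (Fin m)) :
    spechtModule K lam ≤ (spechtModule K lam).comap (mvPolynomialPermRep K m σ) := by
  refine Submodule.span_le.2 ?_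
  rintro _ ⟨T, rfl⟩
  refine Submodule.subset_span ⟨T.trans σ, ?_⟩
  simp [mvPolynomialPermRep, spechtPolynomial, map_prod]

/-- The irreducible representation of `S_m` (in characteristic zero) labeled by `lam`. -/
noncomputable def spechtRep (K : Type*) [Field K] {m : ℕ} (lam : Nat.Partition m) :
    Representation K (Equiv.Perm (Fin m)) (spechtModule K lam) :=
  (mvPolynomialPermRep K m).subrepresentation (spechtModule K lam) (spechtModule_le_comap K lam)

/-- The irreducible character `χ^lam` of `S_m`. -/
noncomputable def spechtCharacter (K : Type*) [Field K] {m : ℕ} (lam : Nat.Partition m) :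
    Equiv.Perm (Fin m) → K :=
  (spechtRep K lam).character

/-- The multiplicity of `χ^lam` in the `m`-th cocharacter of `ρ`, as the scalar product
`(1 / m!) ∑ g, χ_m(g) χ^lam(g⁻¹)` of characters. -/
noncomputable def cocharacterMult {K L A : Type*} [Field K] [LieRing L] [LieAlgebra K L] [Ring A]
    [Algebra K A] (ρ : L →ₗ⁅K⁆ A) {m : ℕ} (lam : Nat.Partition m) : K :=
  (Nat.factorial m : K)⁻¹ *
    ∑ g : Equiv.Perm (Fin m), cocharacter ρ m g * spechtCharacter K lam g⁻¹

/-- The partition `(d - 1, 1)` of `d`. -/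
def partitionSubOneOne (d : ℕ) (hd : 2 ≤ d) : Nat.Partition d where
  parts := {d - 1, 1}
  parts_pos := by
    intro i hi
    simp only [Multiset.insert_eq_cons, Multiset.mem_cons, Multiset.mem_singleton] at hi
    omega
  parts_sum := by
    simp only [Multiset.insert_eq_cons, Multiset.sum_cons, Multiset.sum_singleton]
    omega

/-- The matrix `∑_{i=1}^{d-1} i E_{i,i+1}`; rows and columns are numbered from `0` here. -/
def sl2MatE (d : ℕ) : Matrix (Fin d) (Fin d) ℂ :=
  Matrix.of fun i j => if (j : ℕ) = i + 1 then (i : ℂ) + 1 else 0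

/-- The matrix `∑_{i=1}^{d-1} (d - i) E_{i+1,i}`; rows and columns are numbered from `0` here. -/
def sl2MatF (d : ℕ) : Matrix (Fin d) (Fin d) ℂ :=
  Matrix.of fun i j => if (i : ℕ) = j + 1 then (d : ℂ) - (j + 1) else 0

/-- The matrix `∑_{i=1}^{d} (d + 1 - 2 i) E_{i,i}`; rows and columns are numbered from `0` here. -/
def sl2MatH (d : ℕ) : Matrix (Fin d) (Fin d) ℂ :=
  Matrix.diagonal fun i => (d : ℂ) + 1 - 2 * ((i : ℂ) + 1)

theorem sl2Mat_HE (d : ℕ) : sl2MatH d * sl2MatE d - sl2MatE d * sl2MatH d = 2 • sl2MatE d := by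
  ext i j
  simp only [sl2MatH, sl2MatE, Matrix.sub_apply, Matrix.diagonal_mul, Matrix.mul_diagonal,
    Matrix.of_apply, Matrix.smul_apply]
  split_ifs with h
  · rw [h]; push_cast; simp only [nsmul_eq_mul]; push_cast; ring
  · simp

theorem sl2Mat_HF (d : ℕ) :
    sl2MatH d * sl2MatF d - sl2MatF d * sl2MatH d = -(2 • sl2MatF d) := by
  ext i j
  simp only [sl2MatH, sl2MatF, Matrix.sub_apply, Matrix.diagonal_mul, Matrix.mul_diagonal,
    Matrix.of_apply, Matrix.smul_apply, Matrix.neg_apply]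
  split_ifs with h
  · rw [h]; push_cast; simp only [nsmul_eq_mul]; push_cast; ring
  · simp

theorem sl2Mat_EF (d : ℕ) : sl2MatE d * sl2MatF d - sl2MatF d * sl2MatE d = sl2MatH d := by
  have h1 : sl2MatE d * sl2MatF d =
      Matrix.diagonal fun i : Fin d => ((i : ℂ) + 1) * ((d : ℂ) - (i + 1)) := by
    ext i j
    simp only [sl2MatE, sl2MatF, Matrix.mul_apply, Matrix.of_apply, Matrix.diagonal_apply]
    by_cases hi : (i : ℕ) + 1 < d
    · rw [Finset.sum_eq_single (⟨i + 1, hi⟩ : Fin d)]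
      · by_cases hij : i = j
        · subst hij; simp
        · have : (i : ℕ) ≠ j := fun h => hij (Fin.ext h)
          simp [hij, this]
      · intro k _ hk
        have : (k : ℕ) ≠ i + 1 := fun h => hk (Fin.ext h)
        simp [this]
      · simp
    · have hid : (d : ℂ) = i + 1 := by
        have : d = i + 1 := by omega
        exact_mod_cast this
      rw [Finset.sum_eq_zero]
      · rw [hid]; simp
      · intro k _
        have : (k : ℕ) ≠ i + 1 := by omega
        simp [this]
  have h2 : sl2MatF d * sl2MatE d =
      Matrix.diagonal fun i : Fin d => (i : ℂ) * ((d : ℂ) - i) := by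
    ext i j
    simp only [sl2MatE, sl2MatF, Matrix.mul_apply, Matrix.of_apply, Matrix.diagonal_apply]
    by_cases hi : 0 < (i : ℕ)
    · obtain ⟨n, hn⟩ : ∃ n, (i : ℕ) = n + 1 := ⟨i - 1, by omega⟩
      have hnd : n < d := by omega
      rw [Finset.sum_eq_single (⟨n, hnd⟩ : Fin d)]
      · by_cases hij : i = j
        · subst hij; simp [hn]; ring
        · have : (j : ℕ) ≠ n + 1 := fun h => hij (Fin.ext (hn.trans h.symm))
          simp [hij, this]
      · intro k _ hk
        have : (i : ℕ) ≠ k + 1 := fun h => hk (Fin.ext (by simp; omega))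
        simp [this]
      · simp
    · have hi0 : (i : ℕ) = 0 := by omega
      rw [Finset.sum_eq_zero]
      · simp [hi0]
      · intro k _
        have : (i : ℕ) ≠ k + 1 := by omega
        simp [this]
  rw [h1, h2, sl2MatH, Matrix.diagonal_sub]
  congr 1
  funext i
  ring

/-- The `d`-dimensional irreducible representation of `sl₂(ℂ)` in matrix form: the Lie algebra
homomorphism with `e ↦ sl2MatE d`, `f ↦ sl2MatF d`, `h ↦ sl2MatH d`. -/
def sl2Rep (d : ℕ) :
    LieAlgebra.SpecialLinear.sl (Fin 2) ℂ →ₗ⁅ℂ⁆ Matrix (Fin d) (Fin d) ℂ where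
  toFun A := A.1 0 1 • sl2MatE d + A.1 1 0 • sl2MatF d + A.1 0 0 • sl2MatH d
  map_add' A B := by
    have h : (A + B).1 = A.1 + B.1 := rfl
    rw [h]
    simp only [Matrix.add_apply]
    module
  map_smul' c A := by
    have h : (c • A).1 = c • A.1 := rfl
    rw [h]
    simp only [Matrix.smul_apply, smul_eq_mul, RingHom.id_apply]
    module
  map_lie' := by
    intro A B
    have hA : A.1 1 1 = -A.1 0 0 := by
      have : Matrix.trace A.1 = 0 := LinearMap.mem_ker.1 A.2
      rw [Matrix.trace_fin_two] at this
      linear_combination this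
    have hB : B.1 1 1 = -B.1 0 0 := by
      have : Matrix.trace B.1 = 0 := LinearMap.mem_ker.1 B.2
      rw [Matrix.trace_fin_two] at this
      linear_combination this
    have hHE := sl2Mat_HE d
    have hHF := sl2Mat_HF d
    have hEF := sl2Mat_EF d
    have hR : ∀ a b c a' b' c' : ℂ,
        ⁅a • sl2MatE d + b • sl2MatF d + c • sl2MatH d,
          a' • sl2MatE d + b' • sl2MatF d + c' • sl2MatH d⁆ =
        (a * b' - b * a') • (sl2MatE d * sl2MatF d - sl2MatF d * sl2MatE d) +
        (c * a' - a * c') • (sl2MatH d * sl2MatE d - sl2MatE d * sl2MatH d) +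
        (c * b' - b * c') • (sl2MatH d * sl2MatF d - sl2MatF d * sl2MatH d) := by
      intro a b c a' b' c'
      rw [LieRing.of_associative_ring_bracket]
      simp only [add_mul, mul_add, smul_mul_assoc, mul_smul_comm]
      module
    have hL : (⁅A, B⁆ : LieAlgebra.SpecialLinear.sl (Fin 2) ℂ).1 = A.1 * B.1 - B.1 * A.1 := rfl
    rw [hR, hHE, hHF, hEF, hL]
    simp only [Matrix.sub_apply, Matrix.mul_apply, Fin.sum_univ_two, hA, hB]
    module

/-- The noncommutative polynomial `x₁^k [x₁, x₂] x₁^(d-2-k)` in two variables. -/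
noncomputable def commutatorWord (d k : ℕ) : FreeAlgebra ℂ (Fin 2) :=
  FreeAlgebra.ι ℂ 0 ^ k *
    (FreeAlgebra.ι ℂ 0 * FreeAlgebra.ι ℂ 1 - FreeAlgebra.ι ℂ 1 * FreeAlgebra.ι ℂ 0) *
    FreeAlgebra.ι ℂ 0 ^ (d - 2 - k)

/-! The character of shape `(d - 1, 1)` is the permutation character of `S_d` on `d` points minus
the trivial one. Hence the multiplicity is a difference of dimensions of invariants of `V = P_d / (I
∩ P_d)`: those of the stabilizer of a point, by Frobenius reciprocity, minus those of `S_d`.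

Invariants are spanned by orbit sums of monomials. Under `S_d` there is one orbit sum, nonzero
because `x_i ↦ h` turns it into `d! h^d`. Under the stabilizer of `i` there is one orbit sum for
each position `k` of `x_i`; with `x_i ↦ y` and `x_j ↦ h` otherwise it becomes a multiple of `h^k y
h^(d-1-k)`. If these `d` sums are independent, the multiplicity is `d - 1`.

Independence is interpolation. Let `w_0, ..., w_{d-1}` be the eigenvalues of `h`. The entries of a
relation next to the diagonal for `y = e` say that the binary form `∑ c_k s^k t^(d-1-k)` vanishes at
the `d - 1` points `(w_j : w_{j+1})`; a diagonal entry for `y = h` adds the point `(1 : 1)`. A form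
of degree `d - 1` with `d` distinct zeros is zero (`binaryForm_eq_zero`,
`eq_zero_of_sum_pow_mul_pow_eq_zero`). For the commutator words the degree is `d - 2`, and the first
`d - 1` points suffice. -/

/-- A binary form of degree `n - 1` that vanishes at `n` distinct points of the projective line
is zero. -/
theorem binaryForm_eq_zero {K : Type*} [Field K] {n : ℕ} (s t : Fin n → K)
    (hst : ∀ i j, i ≠ j → s i * t j - s j * t i ≠ 0) (c : Fin n → K)
    (hc : ∀ j, ∑ k : Fin n, c k * (s j ^ (k : ℕ) * t j ^ (n - 1 - k)) = 0) : c = 0 := by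
  refine Matrix.eq_zero_of_mulVec_eq_zero (M := Matrix.projVandermonde s t) ?_ ?_
  · rw [Matrix.det_projVandermonde]
    refine Finset.prod_ne_zero_iff.2 fun i _ => Finset.prod_ne_zero_iff.2 fun j hj => ?_
    exact hst j i (Finset.mem_Ioi.1 hj).ne'
  · funext j
    rw [Pi.zero_apply, ← hc j, Matrix.mulVec, dotProduct]
    refine Finset.sum_congr rfl fun k _ => ?_
    have hk : (Fin.rev k : ℕ) = n - 1 - k := by rw [Fin.val_rev]; omega
    rw [Matrix.projVandermonde_apply, hk, mul_comm]

/-! ### Weights of the representation and interpolation at ratios of consecutive weights -/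

/-- The raising element `e` of `sl₂(ℂ)`. -/
def sl2E : LieAlgebra.SpecialLinear.sl (Fin 2) ℂ :=
  ⟨!![0, 1; 0, 0], LinearMap.mem_ker.2 (by simp [Matrix.trace_fin_two])⟩

/-- The diagonal element `h` of `sl₂(ℂ)`. -/
def sl2H : LieAlgebra.SpecialLinear.sl (Fin 2) ℂ :=
  ⟨!![1, 0; 0, -1], LinearMap.mem_ker.2 (by simp [Matrix.trace_fin_two])⟩

theorem sl2Rep_E (d : ℕ) : sl2Rep d sl2E = sl2MatE d := by
  change (_ : ℂ) • sl2MatE d + (_ : ℂ) • sl2MatF d + (_ : ℂ) • sl2MatH d = _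
  simp [sl2E]

theorem sl2Rep_H (d : ℕ) : sl2Rep d sl2H = sl2MatH d := by
  change (_ : ℂ) • sl2MatE d + (_ : ℂ) • sl2MatF d + (_ : ℂ) • sl2MatH d = _
  simp [sl2H]

/-- The weights of the `d`-dimensional irreducible representation of `sl₂(ℂ)`. -/
def sl2Weight (d i : ℕ) : ℂ := (d : ℂ) + 1 - 2 * ((i : ℂ) + 1)

theorem sl2Weight_inj {d i j : ℕ} (h : sl2Weight d i = sl2Weight d j) : i = j := by
  have : (i : ℂ) = j := by
    unfold sl2Weight at h
    linear_combination -h / 2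
  exact_mod_cast this

theorem sl2Weight_succ (d i : ℕ) : sl2Weight d (i + 1) = sl2Weight d i - 2 := by
  unfold sl2Weight
  push_cast
  ring

theorem sl2Weight_zero_ne_zero {d : ℕ} (hd : 2 ≤ d) : sl2Weight d 0 ≠ 0 := by
  have h : (d : ℂ) ≠ 1 := by
    have : d ≠ 1 := by omega
    exact_mod_cast this
  intro h0
  refine h ?_
  unfold sl2Weight at h0
  linear_combination h0

theorem sl2MatH_pow_mul_mul_pow_apply {d : ℕ} (Y : Matrix (Fin d) (Fin d) ℂ) (a b : ℕ)
    (i j : Fin d) :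
    (sl2MatH d ^ a * Y * sl2MatH d ^ b) i j = sl2Weight d i ^ a * Y i j * sl2Weight d j ^ b := by
  have h : sl2MatH d = Matrix.diagonal fun i : Fin d => sl2Weight d i := rfl
  rw [h, Matrix.diagonal_pow, Matrix.diagonal_pow, Matrix.mul_diagonal, Matrix.diagonal_mul]
  rfl

theorem sl2MatE_apply_succ {d i : ℕ} (hi : i + 1 < d) :
    sl2MatE d ⟨i, by omega⟩ ⟨i + 1, hi⟩ = (i : ℂ) + 1 := by
  simp [sl2MatE]

/-- The points `(w i : w (i + 1))` of the projective line given by consecutive weights are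
distinct. -/
theorem sl2Weight_mul_sub_ne_zero {d i j : ℕ} (hij : i ≠ j) :
    sl2Weight d i * sl2Weight d (j + 1) - sl2Weight d j * sl2Weight d (i + 1) ≠ 0 := by
  rw [sl2Weight_succ, sl2Weight_succ]
  intro h
  refine hij (sl2Weight_inj (d := d) ?_)
  linear_combination -h / 2

/-- A polynomial `∑ c_k x ^ k y x ^ (d - 1 - k)` that vanishes for `x = h` and all `y` in `sl₂(ℂ)`
under the `d`-dimensional irreducible representation is zero. -/
theorem eq_zero_of_sum_pow_mul_pow_eq_zero {d : ℕ} (hd : 2 ≤ d) (c : Fin d → ℂ)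
    (hc : ∀ y, ∑ k : Fin d, c k • (sl2MatH d ^ (k : ℕ) * sl2Rep d y * sl2MatH d ^ (d - 1 - k)) = 0) :
    c = 0 := by
  have hd0 : 0 < d := by omega
  -- The last index has no successor weight; it carries the extra point `(1 : 1)`.
  refine binaryForm_eq_zero (fun j : Fin d => if (j : ℕ) + 1 < d then sl2Weight d j else 1)
    (fun j : Fin d => if (j : ℕ) + 1 < d then sl2Weight d (j + 1) else 1) ?_ c ?_
  · intro i j hij
    have hij' : (i : ℕ) ≠ j := fun h => hij (Fin.ext h)
    have hi := i.isLt
    have hj := j.isLt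
    split_ifs with h1 h2 h2
    · exact sl2Weight_mul_sub_ne_zero hij'
    -- Consecutive weights differ by 2, so no point `(w_i : w_{i+1})` equals `(1 : 1)`.
    · rw [sl2Weight_succ]; norm_num
    · rw [sl2Weight_succ]; norm_num
    · omega
  · intro j
    split_ifs with h1
    · have h := congrFun (congrFun (hc sl2E) ⟨j, by omega⟩) ⟨j + 1, h1⟩
      simp only [Matrix.sum_apply, Matrix.smul_apply, sl2MatH_pow_mul_mul_pow_apply, sl2Rep_E,
        sl2MatE_apply_succ, Matrix.zero_apply, smul_eq_mul] at h
      have hj : ((j : ℕ) : ℂ) + 1 ≠ 0 := Nat.cast_add_one_ne_zero j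
      refine (mul_eq_zero.1 ?_).resolve_left hj
      rw [← h, Finset.mul_sum]
      exact Finset.sum_congr rfl fun k _ => by ring
    · have h := congrFun (congrFun (hc sl2H) ⟨0, hd0⟩) ⟨0, hd0⟩
      simp only [Matrix.sum_apply, Matrix.smul_apply, sl2MatH_pow_mul_mul_pow_apply, sl2Rep_H,
        Matrix.zero_apply, smul_eq_mul] at h
      -- For `y = h` every term has total degree `d` in `h`, so the corner entry is `w_0 ^ d * ∑
      -- c_k`, where `w_0 = d - 1` is nonzero.
      refine (mul_eq_zero.1 ?_).resolve_left (pow_ne_zero d (sl2Weight_zero_ne_zero hd))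
      rw [← h, Finset.mul_sum]
      refine Finset.sum_congr rfl fun k _ => ?_
      have hk : sl2Weight d 0 ^ d =
          sl2Weight d 0 ^ (k : ℕ) * sl2Weight d 0 * sl2Weight d 0 ^ (d - 1 - k) := by
        rw [← pow_succ, ← pow_add]
        congr 1
        omega
      have hH : sl2MatH d ⟨0, hd0⟩ ⟨0, hd0⟩ = sl2Weight d 0 := Matrix.diagonal_apply_eq _ _
      rw [hH, hk, one_pow, one_pow]
      ring

theorem mem_weakIdentities {K L A : Type*} [Field K] [LieRing L] [LieAlgebra K L] [Ring A]
    [Algebra K A] {ρ : L →ₗ⁅K⁆ A} {X : Type*} {f : FreeAlgebra K X} :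
    f ∈ weakIdentities ρ X ↔ ∀ a : X → L, FreeAlgebra.lift K (fun x => ρ (a x)) f = 0 :=
  Iff.rfl

/-- Since `[h, e] = 2e`, substituting `x₁ = h`, `x₂ = e` turns a relation into `2 ∑ c_k h^k e
h^(d-2-k) = 0`. Its superdiagonal entries give a form of degree `d - 2` with `d - 1` zeros. -/
theorem linearIndependent_commutatorWord (d : ℕ) :
    LinearIndependent ℂ (fun k : Fin (d - 1) =>
      (weakIdentities (sl2Rep d) (Fin 2)).mkQ (commutatorWord d k)) := by
  rw [Fintype.linearIndependent_iff]
  intro c hc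
  refine congrFun (binaryForm_eq_zero (fun j : Fin (d - 1) => sl2Weight d j)
    (fun j : Fin (d - 1) => sl2Weight d (j + 1)) ?_ c ?_)
  · exact fun i j hij => sl2Weight_mul_sub_ne_zero fun h => hij (Fin.ext h)
  · intro j
    have hj : (j : ℕ) + 1 < d := by omega
    have hc' : ∑ k, c k • commutatorWord d k ∈ weakIdentities (sl2Rep d) (Fin 2) := by
      rw [← Submodule.Quotient.mk_eq_zero, ← Submodule.mkQ_apply, map_sum, ← hc]
      rfl
    have h := mem_weakIdentities.1 hc' ![sl2H, sl2E]
    simp only [map_sum, map_smul, commutatorWord, map_mul, map_pow, map_sub, FreeAlgebra.lift_ι_apply,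
      Matrix.cons_val_zero, Matrix.cons_val_one, sl2Rep_E, sl2Rep_H, sl2Mat_HE] at h
    have h' := congrFun (congrFun h ⟨j, by omega⟩) ⟨j + 1, hj⟩
    simp only [Matrix.sum_apply, Matrix.smul_apply, sl2MatH_pow_mul_mul_pow_apply,
      sl2MatE_apply_succ, Matrix.zero_apply, smul_eq_mul] at h'
    simp only [nsmul_eq_mul] at h'
    have hj0 : 2 * (((j : ℕ) : ℂ) + 1) ≠ 0 :=
      mul_ne_zero two_ne_zero (Nat.cast_add_one_ne_zero j)
    refine (mul_eq_zero.1 ?_).resolve_left hj0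
    rw [← h', Finset.mul_sum]
    refine Finset.sum_congr rfl fun k _ => ?_
    have hk : d - 1 - 1 - (k : ℕ) = d - 2 - k := by omega
    rw [hk]
    push_cast
    ring

/-! ### The Specht module of shape `(d - 1, 1)` and its character -/

theorem mem_partitionDiagram_subOneOne {d : ℕ} (hd : 2 ≤ d) {c : ℕ × ℕ} :
    c ∈ (partitionDiagram (partitionSubOneOne d hd)).cells ↔
      c.1 = 0 ∧ c.2 < d - 1 ∨ c = (1, 0) := by
  have h : (partitionSubOneOne d hd).parts.sort (· ≥ ·) = [d - 1, 1] := by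
    change ((d - 1) ::ₘ {1} : Multiset ℕ).sort (· ≥ ·) = [d - 1, 1]
    rw [Multiset.sort_cons, Multiset.sort_singleton]
    simp only [Multiset.mem_singleton, forall_eq]
    omega
  obtain ⟨a, b⟩ := c
  simp only [partitionDiagram, h, YoungDiagram.mem_cells, YoungDiagram.mem_ofRowLens]
  match a with
  | 0 => simp
  | 1 => simp
  | a + 2 => simp

theorem card_cells_subOneOne {d : ℕ} (hd : 2 ≤ d) :
    Fintype.card {c : ℕ × ℕ // c ∈ (partitionDiagram (partitionSubOneOne d hd)).cells} = d := by
  have h : (partitionDiagram (partitionSubOneOne d hd)).cells =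
      insert (1, 0) ({0} ×ˢ Finset.range (d - 1)) := by
    ext c
    rw [mem_partitionDiagram_subOneOne, Finset.mem_insert, Finset.mem_product,
      Finset.mem_singleton, Finset.mem_range, or_comm]
  rw [Fintype.card_coe, h, Finset.card_insert_of_notMem (by simp), Finset.card_product,
    Finset.card_singleton, Finset.card_range]
  omega

/-- The cells `(0, 0)` and `(1, 0)` are the only pair in a common column of the diagram of
`(d - 1, 1)`, so its Specht polynomials are differences of two variables. -/
theorem spechtPolynomial_subOneOne (K : Type*) [Field K] {d : ℕ} (hd : 2 ≤ d)
    (T : Tableau (partitionSubOneOne d hd)) :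
    spechtPolynomial K T =
      MvPolynomial.X (T ⟨(0, 0), (mem_partitionDiagram_subOneOne hd).2 (Or.inl ⟨rfl, by omega⟩)⟩) -
      MvPolynomial.X (T ⟨(1, 0), (mem_partitionDiagram_subOneOne hd).2 (Or.inr rfl)⟩) := by
  rw [spechtPolynomial, Finset.prod_eq_single
    (⟨(0, 0), (mem_partitionDiagram_subOneOne hd).2 (Or.inl ⟨rfl, by omega⟩)⟩,
     ⟨(1, 0), (mem_partitionDiagram_subOneOne hd).2 (Or.inr rfl)⟩)]
  · rintro ⟨⟨⟨a, b⟩, h1⟩, ⟨⟨a', b'⟩, h2⟩⟩ hmem hne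
    exfalso
    simp only [Finset.mem_filter, Finset.mem_univ, true_and] at hmem
    rw [mem_partitionDiagram_subOneOne] at h1 h2
    simp only [Prod.mk.injEq] at h1 h2
    apply hne
    have ha : a = 0 := by omega
    have hb : b = 0 := by omega
    have ha' : a' = 1 := by omega
    have hb' : b' = 0 := by omega
    subst ha hb ha' hb'
    rfl
  · intro h
    exact absurd (by simp) h

theorem X_sub_X_mem_spechtModule (K : Type*) [Field K] {d : ℕ} (hd : 2 ≤ d) (i j : Fin d) :
    (MvPolynomial.X i - MvPolynomial.X j : MvPolynomial (Fin d) K) ∈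
      spechtModule K (partitionSubOneOne d hd) := by
  by_cases hij : i = j
  · rw [hij, sub_self]
    exact Submodule.zero_mem _
  let T : Tableau (partitionSubOneOne d hd) := Fintype.equivFinOfCardEq (card_cells_subOneOne hd)
  set a := T ⟨(0, 0), (mem_partitionDiagram_subOneOne hd).2 (Or.inl ⟨rfl, by omega⟩)⟩ with ha
  set b := T ⟨(1, 0), (mem_partitionDiagram_subOneOne hd).2 (Or.inr rfl)⟩ with hb
  have hab : a ≠ b := by
    intro h
    have := congrArg Subtype.val (T.injective h)
    simp at this
  obtain ⟨σ, h1, h2⟩ : ∃ σ : Equiv.Perm (Fin d), σ a = i ∧ σ b = j := by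
    -- The first swap takes `a` to `i`; the second moves the image of `b` to `j` and fixes `i`,
    -- which differs from both.
    refine ⟨Equiv.swap (Equiv.swap a i b) j * Equiv.swap a i, ?_, ?_⟩
    · rw [Equiv.Perm.mul_apply, Equiv.swap_apply_left, Equiv.swap_apply_of_ne_of_ne _ hij]
      intro h
      have h' := congrArg (Equiv.swap a i) h
      rw [Equiv.swap_apply_right, Equiv.swap_apply_self] at h'
      exact hab h'
    · rw [Equiv.Perm.mul_apply, Equiv.swap_apply_left]
  refine Submodule.subset_span ⟨T.trans σ, ?_⟩
  simp only [spechtPolynomial_subOneOne, Equiv.trans_apply]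
  rw [← ha, ← hb, h1, h2]

theorem spechtModule_subOneOne (K : Type*) [Field K] {d : ℕ} (hd : 2 ≤ d) :
    spechtModule K (partitionSubOneOne d hd) =
      Submodule.span K (Set.range fun p : Fin d × Fin d =>
        (MvPolynomial.X p.1 - MvPolynomial.X p.2 : MvPolynomial (Fin d) K)) := by
  refine le_antisymm (Submodule.span_le.2 ?_) (Submodule.span_le.2 ?_)
  · rintro _ ⟨T, rfl⟩
    exact Submodule.subset_span ⟨(_, _), (spechtPolynomial_subOneOne K hd T).symm⟩
  · rintro _ ⟨p, rfl⟩
    exact X_sub_X_mem_spechtModule K hd p.1 p.2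

/-- The linear form with coefficients `a - (average of a)`, as an element of the Specht module of
shape `(d - 1, 1)`. -/
noncomputable def spechtProj (K : Type*) [Field K] {d : ℕ} (hd : 2 ≤ d) :
    (Fin d → K) →ₗ[K] spechtModule K (partitionSubOneOne d hd) :=
  (d : K)⁻¹ • ∑ i : Fin d, ∑ j : Fin d, (LinearMap.proj i).smulRight
    ⟨MvPolynomial.X i - MvPolynomial.X j, X_sub_X_mem_spechtModule K hd i j⟩

theorem coe_spechtProj_apply {K : Type*} [Field K] [CharZero K] {d : ℕ} (hd : 2 ≤ d)
    (a : Fin d → K) : (spechtProj K hd a : MvPolynomial (Fin d) K) =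
      ∑ i, a i • MvPolynomial.X i - ((d : K)⁻¹ * ∑ i, a i) • ∑ j, MvPolynomial.X j := by
  have hd0 : (d : K) ≠ 0 := by
    have : d ≠ 0 := by omega
    exact_mod_cast this
  simp only [spechtProj, LinearMap.smul_apply, LinearMap.sum_apply, LinearMap.smulRight_apply,
    LinearMap.proj_apply, Submodule.coe_smul, AddSubmonoidClass.coe_finsetSum, smul_sub,
    Finset.sum_sub_distrib, Finset.sum_const, Finset.card_univ, Fintype.card_fin]
  congr 1
  · rw [← Finset.smul_sum, ← Nat.cast_smul_eq_nsmul K, smul_smul, inv_mul_cancel₀ hd0, one_smul]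
  · simp only [← Finset.smul_sum, ← Finset.sum_smul, smul_smul]

/-- The coefficients of the linear part of a polynomial in a Specht module. -/
noncomputable def spechtCoeff (K : Type*) [Field K] {d : ℕ} (lam : Nat.Partition d) :
    spechtModule K lam →ₗ[K] (Fin d → K) :=
  LinearMap.pi fun i => MvPolynomial.lcoeff K (Finsupp.single i 1) ∘ₗ Submodule.subtype _

theorem spechtCoeff_apply {K : Type*} [Field K] {d : ℕ} (lam : Nat.Partition d)
    (p : spechtModule K lam) (i : Fin d) :
    spechtCoeff K lam p i = MvPolynomial.coeff (Finsupp.single i 1) (p : MvPolynomial (Fin d) K) :=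
  rfl

/-- Elements of this Specht module are linear forms with coefficient sum zero, so subtracting the
average changes nothing. This exhibits the module as a retract of `K^d`, where traces can be
computed in the standard basis. -/
theorem spechtProj_comp_spechtCoeff {K : Type*} [Field K] [CharZero K] {d : ℕ} (hd : 2 ≤ d) :
    spechtProj K hd ∘ₗ spechtCoeff K (partitionSubOneOne d hd) = LinearMap.id := by
  refine LinearMap.ext ?_
  rintro ⟨p, hp⟩
  refine Subtype.ext ?_
  rw [LinearMap.comp_apply, coe_spechtProj_apply]
  simp only [spechtCoeff_apply, LinearMap.id_apply]
  rw [spechtModule_subOneOne] at hp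
  induction hp using Submodule.span_induction with
  | mem x hx =>
    obtain ⟨⟨i, j⟩, rfl⟩ := hx
    simp [sub_smul, Finset.sum_sub_distrib]
  | zero => simp
  | add x y _ _ hx hy =>
    nth_rewrite 3 [← hx]
    nth_rewrite 3 [← hy]
    simp only [MvPolynomial.coeff_add, add_smul, Finset.sum_add_distrib, mul_add]
    abel
  | smul c x _ hx =>
    nth_rewrite 3 [← hx]
    simp only [MvPolynomial.coeff_smul, smul_eq_mul, mul_smul, ← Finset.mul_sum,
      ← Finset.smul_sum, smul_sub]
    rw [smul_comm c (d : K)⁻¹]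

/-- The character of the Specht module of shape `(d - 1, 1)`. -/
theorem spechtCharacter_subOneOne (K : Type*) [Field K] [CharZero K] {d : ℕ} (hd : 2 ≤ d)
    (g : Equiv.Perm (Fin d)) :
    spechtCharacter K (partitionSubOneOne d hd) g = (∑ i : Fin d, if g i = i then 1 else 0) - 1 := by
  have hd0 : (d : K) ≠ 0 := by
    have : d ≠ 0 := by omega
    exact_mod_cast this
  have hfin : FiniteDimensional K (spechtModule K (partitionSubOneOne d hd)) := by
    rw [spechtModule_subOneOne]
    exact FiniteDimensional.span_of_finite K (Set.finite_range _)
  -- Inserting the retraction and using `tr(AB) = tr(BA)` moves the trace to `K^d`.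
  have h1 : spechtRep K (partitionSubOneOne d hd) g =
      (spechtRep K (partitionSubOneOne d hd) g ∘ₗ spechtProj K hd) ∘ₗ
        spechtCoeff K (partitionSubOneOne d hd) := by
    rw [LinearMap.comp_assoc, spechtProj_comp_spechtCoeff, LinearMap.comp_id]
  rw [spechtCharacter, Representation.character, h1, LinearMap.trace_comp_comm',
    LinearMap.trace_eq_matrix_trace K (Pi.basisFun K (Fin d)), Matrix.trace]
  have h2 : ∀ i : Fin d, spechtCoeff K (partitionSubOneOne d hd)
      (spechtRep K (partitionSubOneOne d hd) g (spechtProj K hd (Pi.single i 1))) i =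
      (if g i = i then 1 else 0) - (d : K)⁻¹ := by
    intro i
    have h3 : (spechtRep K (partitionSubOneOne d hd) g (spechtProj K hd (Pi.single i 1)) :
        MvPolynomial (Fin d) K) =
        MvPolynomial.X (g i) - (d : K)⁻¹ • ∑ j, MvPolynomial.X j := by
      change MvPolynomial.rename g (spechtProj K hd (Pi.single i 1) : MvPolynomial (Fin d) K) = _
      rw [coe_spechtProj_apply]
      simp only [map_sub, map_smul, map_sum, MvPolynomial.rename_X, Pi.single_apply, ite_smul,
        one_smul, zero_smul, Finset.sum_ite_eq', Finset.mem_univ, if_true, mul_one]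
      rw [Equiv.sum_comp g fun j => (MvPolynomial.X j : MvPolynomial (Fin d) K)]
    rw [spechtCoeff_apply, h3, MvPolynomial.coeff_sub, MvPolynomial.coeff_smul,
      MvPolynomial.coeff_sum]
    simp
  simp only [Matrix.diag_apply, LinearMap.toMatrix_apply, Pi.basisFun_apply, Pi.basisFun_repr,
    LinearMap.comp_apply, h2, Finset.sum_sub_distrib, Finset.sum_const, Finset.card_univ,
    Fintype.card_fin, nsmul_eq_mul, mul_inv_cancel₀ hd0]

/-! ### Orbit sums and monomials modulo identities -/

/-- The invariants of a finite group are spanned by the orbit sums of a spanning family. -/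
theorem invariants_eq_span_range_sum {K G V ι : Type*} [Field K] [CharZero K] [Group G] [Fintype G]
    [AddCommGroup V] [Module K V] (τ : Representation K G V) (v : ι → V)
    (hv : Submodule.span K (Set.range v) = ⊤) :
    τ.invariants = Submodule.span K (Set.range fun i => ∑ g, τ g (v i)) := by
  refine le_antisymm ?_ (Submodule.span_le.2 ?_)
  · intro x hx
    -- An invariant vector equals its average over the group, and averaging maps the span of `v`
    -- into the span of the orbit sums.
    have hx' : (Fintype.card G : K)⁻¹ • (∑ g, τ g) x = x := by
      rw [LinearMap.sum_apply, Finset.sum_congr rfl fun g _ => hx g, Finset.sum_const,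
        Finset.card_univ, ← Nat.cast_smul_eq_nsmul K, smul_smul,
        inv_mul_cancel₀ (Nat.cast_ne_zero.2 Fintype.card_ne_zero), one_smul]
    rw [← hx']
    refine Submodule.smul_mem _ _ ?_
    have h : (∑ g, τ g) x ∈ Submodule.map (∑ g, τ g) (Submodule.span K (Set.range v)) :=
      Submodule.mem_map_of_mem (hv ▸ Submodule.mem_top)
    rw [Submodule.map_span, ← Set.range_comp] at h
    convert! h using 4
    simp
  · rintro _ ⟨i, rfl⟩ g
    rw [map_sum]
    simp only [← Module.End.mul_apply, ← map_mul]
    exact Equiv.sum_comp (Equiv.mulLeft g) fun h => τ h (v i)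

/-- The monomial `x_{π(1)} ⋯ x_{π(m)}`, as an element of the multilinear component. -/
noncomputable def multilinearMonomial (K : Type*) [Field K] {m : ℕ} (π : Equiv.Perm (Fin m)) :
    multilinearPart K m :=
  ⟨(List.ofFn fun i => FreeAlgebra.ι K (π i)).prod, Submodule.subset_span ⟨π, rfl⟩⟩

theorem span_range_multilinearMonomial (K : Type*) [Field K] (m : ℕ) :
    Submodule.span K (Set.range (multilinearMonomial K (m := m))) = ⊤ := by
  refine Submodule.map_injective_of_injective (multilinearPart K m).injective_subtype ?_
  rw [Submodule.map_span, ← Set.range_comp, Submodule.map_subtype_top]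
  rfl

instance finiteDimensional_multilinearPart (K : Type*) [Field K] (m : ℕ) :
    FiniteDimensional K (multilinearPart K m) :=
  FiniteDimensional.span_of_finite K (Set.finite_range _)

theorem multilinearRep_multilinearMonomial (K : Type*) [Field K] {m : ℕ}
    (σ π : Equiv.Perm (Fin m)) :
    multilinearRep K m σ (multilinearMonomial K π) = multilinearMonomial K (σ * π) := by
  refine Subtype.ext ?_
  change freeAlgebraPermRep K m σ (List.ofFn fun i => FreeAlgebra.ι K (π i)).prod = _
  simp [freeAlgebraPermRep, multilinearMonomial, map_list_prod, List.map_ofFn, Function.comp_def]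

section Cocharacter

variable {K L A : Type*} [Field K] [LieRing L] [LieAlgebra K L] [Ring A] [Algebra K A]

/-- The class of the monomial `x_{π(1)} ⋯ x_{π(m)}` modulo the identities of `ρ`. -/
noncomputable def cocharacterMonomial (ρ : L →ₗ⁅K⁆ A) {m : ℕ} (π : Equiv.Perm (Fin m)) :
    multilinearPart K m ⧸ (weakIdentities ρ (Fin m)).comap (multilinearPart K m).subtype :=
  Submodule.mkQ _ (multilinearMonomial K π)

theorem span_range_cocharacterMonomial (ρ : L →ₗ⁅K⁆ A) (m : ℕ) :
    Submodule.span K (Set.range (cocharacterMonomial ρ (m := m))) = ⊤ := by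
  have h := Submodule.map_span
    (Submodule.mkQ ((weakIdentities ρ (Fin m)).comap (multilinearPart K m).subtype))
    (Set.range (multilinearMonomial K (m := m)))
  rw [span_range_multilinearMonomial, Submodule.map_top, Submodule.range_mkQ,
    ← Set.range_comp] at h
  exact h.symm

theorem cocharacterRep_cocharacterMonomial (ρ : L →ₗ⁅K⁆ A) {m : ℕ} (σ π : Equiv.Perm (Fin m)) :
    cocharacterRep ρ m σ (cocharacterMonomial ρ π) = cocharacterMonomial ρ (σ * π) := by
  rw [cocharacterMonomial, cocharacterMonomial, ← multilinearRep_multilinearMonomial]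
  rfl

/-- A linear relation between monomials modulo the identities of `ρ` is a relation between their
values under every substitution. -/
theorem sum_smul_list_prod_eq_zero (ρ : L →ₗ⁅K⁆ A) {m : ℕ} {ι : Type*} (s : Finset ι) (c : ι → K)
    (π : ι → Equiv.Perm (Fin m)) (h : ∑ i ∈ s, c i • cocharacterMonomial ρ (π i) = 0)
    (a : Fin m → L) : ∑ i ∈ s, c i • (List.ofFn fun p => ρ (a (π i p))).prod = 0 := by
  have h' : ∑ i ∈ s, c i • multilinearMonomial K (π i) ∈
      (weakIdentities ρ (Fin m)).comap (multilinearPart K m).subtype := by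
    rw [← Submodule.Quotient.mk_eq_zero, ← Submodule.mkQ_apply, map_sum, ← h]
    rfl
  have h2 := mem_weakIdentities.1 (Submodule.mem_comap.1 h') a
  rw [map_sum, map_sum] at h2
  rw [← h2]
  refine Finset.sum_congr rfl fun i _ => ?_
  rw [map_smul, map_smul]
  simp [multilinearMonomial, map_list_prod, List.map_ofFn, Function.comp_def]

end Cocharacter

theorem list_ofFn_const_prod {A : Type*} [Monoid A] (n : ℕ) (x : A) :
    (List.ofFn fun _ : Fin n => x).prod = x ^ n := by
  rw [List.ofFn_const, List.prod_replicate]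

theorem list_ofFn_ite_prod {A : Type*} [Monoid A] (x y : A) :
    ∀ {n : ℕ} (k : Fin n),
      (List.ofFn fun p => if p = k then y else x).prod = x ^ (k : ℕ) * y * x ^ (n - 1 - k)
  | 0, k => k.elim0
  | n + 1, k => by
    rw [List.ofFn_succ, List.prod_cons]
    refine Fin.cases ?_ (fun k => ?_) k
    · simp [Fin.succ_ne_zero]
    · have h0 : (0 : Fin (n + 1)) ≠ k.succ := (Fin.succ_ne_zero k).symm
      have hk : n + 1 - 1 - (k.succ : ℕ) = n - 1 - k := by rw [Fin.val_succ]; omega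
      simp only [Fin.succ_inj, if_neg h0]
      rw [list_ofFn_ite_prod x y k, hk, Fin.val_succ, pow_succ']
      simp only [mul_assoc]

/-! ### Dimensions of the invariants -/

theorem finrank_invariants_cocharacterRep {d : ℕ} (hd : 2 ≤ d) :
    Module.finrank ℂ (cocharacterRep (sl2Rep d) d).invariants = 1 := by
  have h1 : ∀ π : Equiv.Perm (Fin d),
      ∑ g, cocharacterRep (sl2Rep d) d g (cocharacterMonomial (sl2Rep d) π) =
        ∑ g, cocharacterMonomial (sl2Rep d) g := by
    intro π
    simp only [cocharacterRep_cocharacterMonomial]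
    exact Equiv.sum_comp (Equiv.mulRight π) fun g => cocharacterMonomial (sl2Rep d) g
  rw [invariants_eq_span_range_sum _ _ (span_range_cocharacterMonomial (sl2Rep d) d)]
  rw [funext h1, Set.range_const]
  refine finrank_span_singleton fun h => ?_
  have h2 := sum_smul_list_prod_eq_zero (sl2Rep d) Finset.univ (fun _ => 1) id
    (by simpa only [one_smul, id] using h) fun _ => sl2H
  simp only [list_ofFn_const_prod, one_smul, Finset.sum_const, sl2Rep_H] at h2
  have h3 := congrFun (congrFun h2 ⟨0, by omega⟩) ⟨0, by omega⟩
  have h4 := sl2MatH_pow_mul_mul_pow_apply (1 : Matrix (Fin d) (Fin d) ℂ) d 0 ⟨0, by omega⟩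
    ⟨0, by omega⟩
  rw [mul_one, pow_zero, mul_one, Matrix.one_apply_eq, pow_zero, mul_one, mul_one] at h4
  rw [Matrix.smul_apply, h4, Matrix.zero_apply, ← Nat.cast_smul_eq_nsmul ℂ, smul_eq_mul,
    Finset.card_univ] at h3
  exact mul_ne_zero (Nat.cast_ne_zero.2 Fintype.card_ne_zero)
    (pow_ne_zero d (sl2Weight_zero_ne_zero hd)) h3

/-- The orbit of a monomial under the stabilizer of `i` is determined by the position of `x_i`,
which leaves `d` orbit sums; interpolation shows that they are independent. -/
theorem finrank_invariants_cocharacterRep_stabilizer {d : ℕ} (hd : 2 ≤ d) (i : Fin d) :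
    Module.finrank ℂ (Representation.invariants ((cocharacterRep (sl2Rep d) d).comp
      (MulAction.stabilizer (Equiv.Perm (Fin d)) i).subtype)) = d := by
  set H := MulAction.stabilizer (Equiv.Perm (Fin d)) i
  -- Each `h * swap k i` sends `k` to `i`, so `w k` sums the monomials with `x_i` in position `k`.
  set w : Fin d → _ := fun k => ∑ h : H, cocharacterMonomial (sl2Rep d) ((h : Equiv.Perm (Fin d)) * Equiv.swap k i) with hw
  have h1 : Representation.invariants ((cocharacterRep (sl2Rep d) d).comp H.subtype) =
      Submodule.span ℂ (Set.range w) := by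
    rw [invariants_eq_span_range_sum _ _ (span_range_cocharacterMonomial (sl2Rep d) d)]
    refine le_antisymm (Submodule.span_mono ?_) (Submodule.span_mono ?_)
    · rintro _ ⟨π, rfl⟩
      refine ⟨π⁻¹ i, ?_⟩
      -- The monomial of `π` has `x_i` in position `π⁻¹ i`; this puts `π` in the coset of `H`
      -- represented by `swap (π⁻¹ i) i`.
      have hπ : π * Equiv.swap (π⁻¹ i) i ∈ H := by
        rw [MulAction.mem_stabilizer_iff, Equiv.Perm.smul_def, Equiv.Perm.mul_apply,
          Equiv.swap_apply_right, ← Equiv.Perm.mul_apply, mul_inv_cancel, Equiv.Perm.one_apply]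
      have h := Equiv.sum_comp (Equiv.mulRight (⟨_, hπ⟩ : H)) fun h : H =>
        cocharacterMonomial (sl2Rep d) ((h : Equiv.Perm (Fin d)) * Equiv.swap (π⁻¹ i) i)
      rw [hw]
      dsimp only
      rw [← h]
      refine Finset.sum_congr rfl fun g _ => ?_
      change _ = cocharacterRep (sl2Rep d) d g (cocharacterMonomial (sl2Rep d) π)
      rw [cocharacterRep_cocharacterMonomial]
      congr 1
      simp [mul_assoc]
    · rintro _ ⟨k, rfl⟩
      refine ⟨Equiv.swap k i, Finset.sum_congr rfl fun g _ => ?_⟩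
      change cocharacterRep (sl2Rep d) d g (cocharacterMonomial (sl2Rep d) (Equiv.swap k i)) = _
      rw [cocharacterRep_cocharacterMonomial]
  have h2 : LinearIndependent ℂ w := by
    refine Fintype.linearIndependent_iff.2 fun c hc => ?_
    refine congrFun (eq_zero_of_sum_pow_mul_pow_eq_zero hd c fun y => ?_)
    have hc' : ∑ q : Fin d × H, c q.1 •
        cocharacterMonomial (sl2Rep d) ((q.2 : Equiv.Perm (Fin d)) * Equiv.swap q.1 i) = 0 := by
      rw [Fintype.sum_prod_type, ← hc]
      exact Finset.sum_congr rfl fun k _ => by rw [hw, Finset.smul_sum]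
    have h3 := sum_smul_list_prod_eq_zero (sl2Rep d) Finset.univ (fun q : Fin d × H => c q.1)
      (fun q => (q.2 : Equiv.Perm (Fin d)) * Equiv.swap q.1 i) hc' fun j => if j = i then y else sl2H
    have h4 : ∀ q : Fin d × H, (List.ofFn fun p => sl2Rep d
        (if ((q.2 : Equiv.Perm (Fin d)) * Equiv.swap q.1 i) p = i then y else sl2H)).prod =
        sl2MatH d ^ (q.1 : ℕ) * sl2Rep d y * sl2MatH d ^ (d - 1 - q.1) := by
      rintro ⟨k, g⟩
      rw [← list_ofFn_ite_prod]
      congr 2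
      funext p
      have hp : ((g : Equiv.Perm (Fin d)) * Equiv.swap k i) p = i ↔ p = k := by
        have hg : (g : Equiv.Perm (Fin d)) i = i := g.2
        have hk : ((g : Equiv.Perm (Fin d)) * Equiv.swap k i) k = i := by
          rw [Equiv.Perm.mul_apply, Equiv.swap_apply_left, hg]
        constructor
        · intro h
          exact Equiv.injective _ (h.trans hk.symm)
        · rintro rfl
          exact hk
      simp only [hp, apply_ite (sl2Rep d), sl2Rep_H]
    simp only [h4] at h3
    rw [Fintype.sum_prod_type] at h3
    simp only [Finset.sum_const] at h3
    rw [← Finset.smul_sum, ← Nat.cast_smul_eq_nsmul ℂ] at h3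
    -- All monomials in one orbit sum take the same value, so the relation carries the common factor
    -- `|H|`.
    exact (smul_eq_zero.1 h3).resolve_left
      (Nat.cast_ne_zero.2 (Finset.card_pos.2 Finset.univ_nonempty).ne')
  rw [h1, finrank_span_eq_card h2, Fintype.card_fin]

/-! ### The multiplicity -/

theorem sum_character_eq_card_mul_finrank_invariants {K G V : Type*} [Field K] [CharZero K]
    [Group G] [Fintype G] [AddCommGroup V] [Module K V] [FiniteDimensional K V]
    (τ : Representation K G V) :
    ∑ g, τ.character g = Nat.card G * Module.finrank K τ.invariants := by
  have h0 : (Nat.card G : K) ≠ 0 := Nat.cast_ne_zero.2 Nat.card_pos.ne'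
  let _ : Invertible (Nat.card G : K) := invertibleOfNonzero h0
  rw [← Representation.card_inv_mul_sum_char_eq_finrank, mul_inv_cancel_left₀ h0]

theorem cocharacterMult_subOneOne {d : ℕ} (hd : 2 ≤ d) :
    cocharacterMult (sl2Rep d) (partitionSubOneOne d hd) = (d : ℂ) - 1 := by
  -- The sum over the permutations fixing `i` is the stabilizer order times the dimension `d` of its
  -- invariants, that is `(d - 1)! * d`.
  have h1 : ∀ i : Fin d, ∑ g : Equiv.Perm (Fin d),
      cocharacter (sl2Rep d) d g * (if g i = i then 1 else 0) = (d.factorial : ℂ) := by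
    intro i
    have h := sum_character_eq_card_mul_finrank_invariants ((cocharacterRep (sl2Rep d) d).comp
      (MulAction.stabilizer (Equiv.Perm (Fin d)) i).subtype)
    have hcard : Nat.card (MulAction.stabilizer (Equiv.Perm (Fin d)) i) * d = d.factorial := by
      have := (MulAction.stabilizer (Equiv.Perm (Fin d)) i).card_mul_index
      rwa [MulAction.index_stabilizer_of_transitive, Nat.card_fin, Nat.card_perm, Nat.card_fin]
        at this
    rw [finrank_invariants_cocharacterRep_stabilizer hd, ← Nat.cast_mul, hcard] at h
    rw [← h]
    simp only [mul_ite, mul_one, mul_zero]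
    rw [← Finset.sum_filter]
    exact Finset.sum_subtype _ (fun g => by simp [MulAction.mem_stabilizer_iff]) _
  have h2 := sum_character_eq_card_mul_finrank_invariants (cocharacterRep (sl2Rep d) d)
  rw [finrank_invariants_cocharacterRep hd, Nat.card_perm, Nat.card_fin, Nat.cast_one,
    mul_one] at h2
  have h3 : ∑ g : Equiv.Perm (Fin d), cocharacter (sl2Rep d) d g *
      spechtCharacter ℂ (partitionSubOneOne d hd) g⁻¹ = d * d.factorial - d.factorial := by
    have hfix : ∀ (g : Equiv.Perm (Fin d)) (i : Fin d), g⁻¹ i = i ↔ g i = i := fun g i => by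
      rw [Equiv.Perm.inv_eq_iff_eq, eq_comm]
    simp only [spechtCharacter_subOneOne, hfix, mul_sub, mul_one, Finset.sum_sub_distrib,
      Finset.mul_sum]
    -- Exchanging the sums turns the count of fixed points of `g` into a sum over stabilizers, one
    -- for each `i`.
    rw [Finset.sum_comm]
    congr 1
    rw [Finset.sum_congr rfl fun i _ => h1 i]
    simp
  rw [cocharacterMult, h3]
  have h0 : (d.factorial : ℂ) ≠ 0 := Nat.cast_ne_zero.2 d.factorial_ne_zero
  field_simp

theorem mainTheorem2 :
    (∀ (d : ℕ) (hd : 2 ≤ d),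
      cocharacterMult (sl2Rep d) (partitionSubOneOne d hd) = (d : ℂ) - 1 ∧
      LinearIndependent ℂ (fun k : Fin (d - 1) =>
        (weakIdentities (sl2Rep d) (Fin 2)).mkQ (commutatorWord d k))) ∧
    (∀ B : ℕ, ∃ (d m : ℕ) (lam : Nat.Partition m) (n : ℕ),
      1 ≤ d ∧ cocharacterMult (sl2Rep d) lam = (n : ℂ) ∧ B < n) := by
  refine ⟨fun d hd => ⟨cocharacterMult_subOneOne hd, linearIndependent_commutatorWord d⟩,
    -- With `d = m = B + 2` the multiplicity of `(d - 1, 1)` is `B + 1`.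
    fun B => ⟨B + 2, B + 2, partitionSubOneOne (B + 2) (by omega), B + 1, by omega, ?_, by omega⟩⟩
  rw [cocharacterMult_subOneOne]
  push_cast
  ring
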